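/- Let $X$ be a Polish space with Borel $\sigma$-field $\mathcal B$, and call a set bounded if it is bounded for a fixed metric generating the topology of $X$. Let $\mathcal M(X)$ be the set of locally finite measures on $X$ (Borel measures that are finite on bounded Borel sets), equipped with the $\sigma$-field generated by the evaluations $\zeta_B(\mu)=\mu(B)$, $B\in\mathcal B$. For $B\in\mathcal B$ let $\mathcal G_B=\sigma(\zeta_{B'}:B'\in\mathcal B,\ B'\subseteq B)$. A point process is a probability measure on $\mathcal M(X)$ concentrated on the measures that take integer values on bounded Borel sets. For $z\in(0,1)$ and $\rho\in\mathcal M(X)$, the Pólya sum process $\mathrm{Poy}_{z,\rho}$ is the point process $P$ with Papangelou kernel $z(\rho+\mu)$, that is, with $$\iint f(x,\mu)\,\mu(dx)\,P(d\mu)=\iint f(x,\mu+\delta_x)\,z(\rho+\mu)(dx)\,P(d\mu)$$ for all measurable $f:X\times\mathcal M(X)\to[0,\infty]$. Fix $\rho\in\mathcal M(X)$, and for $0\le s<t<1$ and $\nu\in\mathcal M(X)$ let $$p_{s,t}(\nu,\cdot)=\mathrm{Poy}_{\frac{t-s}{1-s},\,\rho+\nu}*\Delta_\nu$$ be the transition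 kernels of the spatial Chinese restaurant process, where $\Delta_\nu$ is the unit mass at $\nu$ and $*$ is convolution of probability measures on $(\mathcal M(X),+)$. Write $p_{s,t}(\nu,\phi)=\int\phi(\mu)\,p_{s,t}(\nu,d\mu)$. **Lemma.** Let $\nu\in\mathcal M(X)$, let $0\le s<1$, let $B\subseteq X$ be a bounded Borel set and let $\phi:\mathcal M(X)\to\mathbb R$ be bounded and $\mathcal G_B$-measurable. Then $x\mapsto\phi(\nu+\delta_x)-\phi(\nu)$ is $(\rho+\nu)$-integrable, the limit $$\mathcal A_s\phi(\nu)=\lim_{h\downarrow0}\frac1h\bigl[p_{s,s+h}(\nu,\phi)-\phi(\nu)\bigr]$$ exists, and $$\mathcal A_s\phi(\nu)=\frac1{1-s}\int\bigl[\phi(\nu+\delta_x)-\phi(\nu)\bigr]\,(\rho+\nu)(dx).$$ -/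

import Mathlib

open MeasureTheory Filter Topology
open scoped ENNReal

namespace PolyaSum

/-- The locally finite measures on `X`: Borel measures that are finite on every bounded Borel set
(bounded with respect to the given metric). They form an additive submonoid of all measures. -/
def locFin (X : Type*) [MetricSpace X] [MeasurableSpace X] : AddSubmonoid (Measure X) where
  carrier := {μ | ∀ B : Set X, MeasurableSet B → Bornology.IsBounded B → μ B < ∞}
  zero_mem' := by
    intro B _ _
    simp
  add_mem' := by
    intro μ ν hμ hν B hB hb
    rw [Measure.add_apply]
    exact ENNReal.add_lt_top.2 ⟨hμ B hB hb, hν B hB hb⟩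

/-- The space `M(X)` of locally finite measures. As a subtype of `Measure X` it carries the
`σ`-field `G` generated by the evaluations `μ ↦ μ B`, `B` Borel. -/
abbrev LocFinMeasure (X : Type*) [MetricSpace X] [MeasurableSpace X] : Type _ := ↥(locFin X)

/-- The unit mass at `x` as a locally finite measure. -/
noncomputable def unitMass {X : Type*} [MetricSpace X] [MeasurableSpace X] (x : X) :
    LocFinMeasure X :=
  ⟨Measure.dirac x, fun B _ _ => measure_lt_top _ B⟩

/-- The `σ`-field `G_B` on `M(X)`, generated by the evaluations `μ ↦ μ B'` for Borel `B' ⊆ B`. -/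
abbrev localSigma {X : Type*} [MetricSpace X] [MeasurableSpace X] (B : Set X) :
    MeasurableSpace (LocFinMeasure X) :=
  ⨆ (B' : Set X) (_ : MeasurableSet B') (_ : B' ⊆ B),
    MeasurableSpace.comap (fun μ : LocFinMeasure X => (μ : Measure X) B') inferInstance

/-- Locally finite point measures: integer-valued on bounded Borel sets. -/
def IsPointMeasure {X : Type*} [MetricSpace X] [MeasurableSpace X] (μ : LocFinMeasure X) : Prop :=
  ∀ B : Set X, MeasurableSet B → Bornology.IsBounded B → ∃ n : ℕ, (μ : Measure X) B = n

/-- A point process: a probability measure on `M(X)` concentrated on the point measures. -/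
structure IsPointProcess {X : Type*} [MetricSpace X] [MeasurableSpace X]
    (P : Measure (LocFinMeasure X)) : Prop where
  isProbabilityMeasure : IsProbabilityMeasure P
  ae_isPointMeasure : ∀ᵐ μ ∂P, IsPointMeasure μ

/-- The Campbell measure of `P`, as a functional of non-negative functions on `X × M(X)`. -/
noncomputable def campbell {X : Type*} [MetricSpace X] [MeasurableSpace X]
    (P : Measure (LocFinMeasure X)) (f : X × LocFinMeasure X → ℝ≥0∞) : ℝ≥0∞ :=
  ∫⁻ μ, ∫⁻ x, f (x, μ) ∂(μ : Measure X) ∂P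

/-- `P` is a Papangelou process with Papangelou kernel `κ`: it is a point process and
`C_P(f) = ∬ f(x, μ + δ_x) κ(μ, dx) P(dμ)` for all measurable `f ≥ 0`. -/
structure IsPapangelou {X : Type*} [MetricSpace X] [MeasurableSpace X]
    (P : Measure (LocFinMeasure X)) (κ : LocFinMeasure X → Measure X) : Prop where
  isPointProcess : IsPointProcess P
  campbell_eq : ∀ f : X × LocFinMeasure X → ℝ≥0∞, Measurable f →
    campbell P f = ∫⁻ μ, ∫⁻ x, f (x, μ + unitMass x) ∂(κ μ) ∂P

open Classical in
/-- The Pólya sum process `Poy_{z,ρ}`, `0 < z < 1`: the point process determined by the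
Papangelou kernel `κ(μ, ·) = z (ρ + μ)`. (Value `0` if there is no such process.) -/
noncomputable def polyaSum {X : Type*} [MetricSpace X] [MeasurableSpace X]
    (z : ℝ) (ρ : LocFinMeasure X) : Measure (LocFinMeasure X) :=
  if h : ∃ P : Measure (LocFinMeasure X),
      IsPapangelou P (fun μ => ENNReal.ofReal z • ((ρ + μ : LocFinMeasure X) : Measure X))
  then h.choose else 0

/-- The transition kernels `p_{s,t}(ν, ·) = Poy_{(t-s)/(1-s), ρ+ν} ∗ Δ_ν`, `0 ≤ s < t < 1`. -/
noncomputable def transition {X : Type*} [MetricSpace X] [MeasurableSpace X]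
    (ρ : LocFinMeasure X) (s t : ℝ) (ν : LocFinMeasure X) : Measure (LocFinMeasure X) :=
  (polyaSum ((t - s) / (1 - s)) (ρ + ν)).conv (Measure.dirac ν)

/-- `A_s φ(ν)` exists and equals `a`: the limit of `(p_{s,s+h}(ν, φ) - φ(ν)) / h` as `h ↓ 0`
is `a`. -/
def HasGeneratorAt {X : Type*} [MetricSpace X] [MeasurableSpace X]
    (ρ : LocFinMeasure X) (s : ℝ) (φ : LocFinMeasure X → ℝ) (ν : LocFinMeasure X) (a : ℝ) : Prop :=
  Tendsto (fun h : ℝ => (1 / h) * (∫ μ, φ μ ∂(transition ρ s (s + h) ν) - φ ν)) (𝓝[>] 0) (𝓝 a)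

end PolyaSum

/-! The generator is the first-order expansion, as `z` tends to `0`, of the Pólya sum process with
parameter `z = h / (1 - s)` and base `σ = ρ + ν`. Write `N` for the number of points in `B`. Up to
an error of order `z ^ 2`, the trace on `B` is empty or is one point, and that point is distributed
as `z` times `σ` restricted to `B`. All of this follows from the Papangelou identity with suitable
test functions: `IsPapangelou.measure_le_eval` gives `P(N ≥ 1) = O(z)` and then `P(N ≥ 2) = O(z ^
2)`, and `IsPapangelou.measure_eval_eq_one_inter` gives the exact law on `N = 1`. They combine in
`IsPapangelou.abs_integral_sub_le`, applied to `ψ μ = φ (μ + ν) - φ ν`.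

Since `polyaSum` is defined by choice with default value `0`, existence must be proved too;
uniqueness is not needed, because the estimates hold for every process with this kernel. For a
finite base the process is a mixture over `n` of Pólya urn laws with weights proportional to `z ^ n
/ n!`. Exchangeability of the draws yields the Papangelou identity (`campbell_urn_succ`). For a
general base, independent processes on bounded shells are glued together; resampling one coordinate
of the product reduces the identity to a single shell. -/

namespace PolyaSum

open ProbabilityTheory

/-! ### Bounded shells and measurability of integrals against locally finite measures -/

section Basic

variable {X : Type*} [MetricSpace X] [MeasurableSpace X]

lemma coe_unitMass (x : X) : ((unitMass x : LocFinMeasure X) : Measure X) = Measure.dirac x := rfl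

lemma coe_add (μ ν : LocFinMeasure X) :
    ((μ + ν : LocFinMeasure X) : Measure X) = (μ : Measure X) + (ν : Measure X) := rfl

lemma measurable_unitMass : Measurable (unitMass : X → LocFinMeasure X) :=
  Measure.measurable_dirac.subtype_mk

lemma measurable_eval {B : Set X} (hB : MeasurableSet B) :
    Measurable fun μ : LocFinMeasure X => (μ : Measure X) B :=
  (Measure.measurable_coe hB).comp measurable_subtype_coe

instance measurableAdd₂_locFinMeasure : MeasurableAdd₂ (LocFinMeasure X) :=
  ⟨((measurable_subtype_coe.comp measurable_fst).add
    (measurable_subtype_coe.comp measurable_snd)).subtype_mk⟩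

lemma measurable_add_unitMass :
    Measurable fun p : X × LocFinMeasure X => p.2 + unitMass p.1 :=
  measurable_snd.add (measurable_unitMass.comp measurable_fst)

/-- The integer part of the distance to a fixed base point. -/
noncomputable def shellIndex (x : X) : ℕ := ⌊dist x (Classical.choice ⟨x⟩)⌋₊

/-- The `k`-th shell around the base point. The shells are bounded and partition the space. -/
def shell (X : Type*) [MetricSpace X] [MeasurableSpace X] (k : ℕ) : Set X := shellIndex ⁻¹' {k}

/-- By proof irrelevance `Classical.choice ⟨x⟩` is the same point for all `x`, so the index is the
floor of a continuous distance function. -/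
lemma measurable_shellIndex [OpensMeasurableSpace X] : Measurable (shellIndex : X → ℕ) := by
  rcases isEmpty_or_nonempty X with h | ⟨⟨x₀⟩⟩
  · exact measurable_of_empty _
  · exact Nat.measurable_floor.comp
      (continuous_id.dist (continuous_const (y := Classical.choice ⟨x₀⟩))).measurable

lemma measurableSet_shell [OpensMeasurableSpace X] (k : ℕ) : MeasurableSet (shell X k) :=
  measurable_shellIndex (measurableSet_singleton k)

lemma isBounded_shell (k : ℕ) : Bornology.IsBounded (shell X k) := by
  rcases isEmpty_or_nonempty X with h | ⟨⟨x₀⟩⟩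
  · simp [Set.eq_empty_of_isEmpty]
  · refine (Metric.isBounded_closedBall (x := Classical.choice ⟨x₀⟩) (r := k + 1)).subset ?_
    intro x hx
    have hx' : ⌊dist x (Classical.choice ⟨x₀⟩)⌋₊ = k := hx
    rw [Metric.mem_closedBall, ← hx']
    exact (Nat.lt_floor_add_one _).le

omit [MeasurableSpace X] in
lemma exists_shellIndex_lt {B : Set X} (hB : Bornology.IsBounded B) :
    ∃ n, ∀ x ∈ B, shellIndex x < n := by
  rcases isEmpty_or_nonempty X with h | ⟨⟨x₀⟩⟩
  · exact ⟨0, fun x => (h.false x).elim⟩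
  · obtain ⟨r, hr⟩ := hB.subset_closedBall (Classical.choice ⟨x₀⟩)
    refine ⟨⌊r⌋₊ + 1, fun x hx => Nat.lt_succ_of_le (Nat.floor_le_floor ?_)⟩
    exact Metric.mem_closedBall.1 (hr hx)

lemma pairwise_disjoint_shell : Pairwise (Function.onFun Disjoint (shell X)) := by
  intro i j hij
  refine Set.disjoint_left.2 fun x hi hj => hij ?_
  exact (show shellIndex x = i from hi).symm.trans hj

lemma iUnion_shell : ⋃ k, shell X k = Set.univ :=
  Set.eq_univ_of_forall fun x => Set.mem_iUnion.2 ⟨shellIndex x, rfl⟩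

lemma measure_eq_tsum_shell [OpensMeasurableSpace X] (μ : Measure X) {B : Set X}
    (hB : MeasurableSet B) : μ B = ∑' k, μ (B ∩ shell X k) := by
  rw [← measure_iUnion
    (fun i j hij => (pairwise_disjoint_shell hij).mono Set.inter_subset_right
      Set.inter_subset_right) fun k => hB.inter (measurableSet_shell k),
    ← Set.inter_iUnion, iUnion_shell, Set.inter_univ]

lemma measure_eq_sum_shell [OpensMeasurableSpace X] (μ : Measure X) {B : Set X}
    (hB : MeasurableSet B) {n : ℕ} (hn : ∀ x ∈ B, shellIndex x < n) :
    μ B = ∑ k ∈ Finset.range n, μ (B ∩ shell X k) := by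
  rw [measure_eq_tsum_shell μ hB]
  refine tsum_eq_sum fun k hk => ?_
  have : B ∩ shell X k = ∅ := by
    refine Set.eq_empty_of_forall_notMem fun x hx => hk ?_
    rw [Finset.mem_range, ← show shellIndex x = k from hx.2]
    exact hn x hx.1
  rw [this, measure_empty]

lemma mem_locFin_of_shell [OpensMeasurableSpace X] {μ : Measure X}
    (h : ∀ k, μ (shell X k) < ∞) : μ ∈ locFin X := by
  intro B hB hb
  obtain ⟨n, hn⟩ := exists_shellIndex_lt hb
  rw [measure_eq_sum_shell μ hB hn]
  exact ENNReal.sum_lt_top.2 fun k _ => (measure_mono Set.inter_subset_right).trans_lt (h k)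

lemma measure_shell_lt_top [OpensMeasurableSpace X] (μ : LocFinMeasure X) (k : ℕ) :
    (μ : Measure X) (shell X k) < ∞ :=
  μ.2 _ (measurableSet_shell k) (isBounded_shell k)

/-- A kernel whose values are finite measures is s-finite. -/
lemma isSFiniteKernel_of_forall_lt_top {α β : Type*} [MeasurableSpace α] [MeasurableSpace β]
    (κ : Kernel α β) (h : ∀ a, κ a Set.univ < ∞) : IsSFiniteKernel κ := by
  classical
  have hm : Measurable fun a => ⌊(κ a Set.univ).toReal⌋₊ :=
    Nat.measurable_floor.comp (κ.measurable_coe MeasurableSet.univ).ennreal_toReal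
  have hs : ∀ n : ℕ, MeasurableSet {a | ⌊(κ a Set.univ).toReal⌋₊ = n} :=
    fun n => hm (measurableSet_singleton n)
  have hfin : ∀ n, IsFiniteKernel (Kernel.piecewise (hs n) κ 0) := by
    intro n
    refine ⟨⟨(n + 1 : ℕ), ENNReal.natCast_lt_top _, fun a => ?_⟩⟩
    rw [Kernel.piecewise_apply]
    split_ifs with ha
    · rw [← ENNReal.ofReal_toReal (h a).ne, ← ENNReal.ofReal_natCast]
      refine ENNReal.ofReal_le_ofReal ?_
      have ha' : ⌊(κ a Set.univ).toReal⌋₊ = n := ha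
      have := (Nat.lt_floor_add_one (κ a Set.univ).toReal).le
      rw [ha'] at this
      exact_mod_cast this
    · simp
  refine ⟨fun n => Kernel.piecewise (hs n) κ 0, hfin, ?_⟩
  ext a t ht
  rw [Kernel.sum_apply' _ _ ht, tsum_eq_single ⌊(κ a Set.univ).toReal⌋₊]
  · rw [Kernel.piecewise_apply, if_pos (by rfl)]
  · intro n hn
    rw [Kernel.piecewise_apply, if_neg (by exact fun h' => hn (Eq.symm h'))]
    simp

/-- The kernel `μ ↦ μ` from the locally finite measures to the underlying space. -/
def evalKernel (X : Type*) [MetricSpace X] [MeasurableSpace X] : Kernel (LocFinMeasure X) X :=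
  ⟨fun μ => μ, measurable_subtype_coe⟩

/-- Each restriction to a shell has finite values, and countably many shells cover the space. This
s-finiteness is what allows Tonelli and joint measurability throughout. -/
instance isSFiniteKernel_evalKernel [OpensMeasurableSpace X] : IsSFiniteKernel (evalKernel X) := by
  have h : ∀ k, IsSFiniteKernel ((evalKernel X).restrict (measurableSet_shell k)) := fun k =>
    isSFiniteKernel_of_forall_lt_top _ fun μ => by
      rw [Kernel.restrict_apply, Measure.restrict_apply_univ]
      exact measure_shell_lt_top μ k
  have e : evalKernel X = Kernel.sum fun k =>
      (evalKernel X).restrict (measurableSet_shell k) := by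
    ext μ B hB
    rw [Kernel.sum_apply' _ _ hB, measure_eq_tsum_shell _ hB]
    refine tsum_congr fun k => ?_
    rw [Kernel.restrict_apply, Measure.restrict_apply hB]
  rw [e]
  infer_instance

instance sFinite_coe [OpensMeasurableSpace X] (μ : LocFinMeasure X) : SFinite (μ : Measure X) :=
  inferInstanceAs (SFinite (evalKernel X μ))

/-- Integrals of jointly measurable functions against locally finite measures depend measurably
on all parameters. -/
lemma measurable_lintegral_coe [OpensMeasurableSpace X] {α : Type*} [MeasurableSpace α]
    {m : α → LocFinMeasure X} (hm : Measurable m) {f : α → X → ℝ≥0∞}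
    (hf : Measurable (Function.uncurry f)) :
    Measurable fun a => ∫⁻ x, f a x ∂(m a : Measure X) :=
  Measurable.lintegral_kernel_prod_right (κ := (evalKernel X).comap m hm) hf

end Basic

/-! ### Measurability of the set of point measures -/

section PointMeasure

variable {X : Type*} [MetricSpace X] [MeasurableSpace X]

lemma isPointMeasure_zero : IsPointMeasure (0 : LocFinMeasure X) :=
  fun B _ _ => ⟨0, by simp⟩

lemma IsPointMeasure.add_unitMass {μ : LocFinMeasure X} (hμ : IsPointMeasure μ) (x : X) :
    IsPointMeasure (μ + unitMass x) := by
  classical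
  intro B hB hb
  obtain ⟨n, hn⟩ := hμ B hB hb
  rw [coe_add, Measure.add_apply, hn, coe_unitMass, Measure.dirac_apply' _ hB]
  by_cases hx : x ∈ B
  · exact ⟨n + 1, by simp [hx]⟩
  · exact ⟨n, by simp [hx]⟩

/-- A finite sum admits only finitely many terms that are at least `1`; the remaining terms, being
natural numbers, vanish. -/
lemma exists_nat_tsum_eq {f : ℕ → ℝ≥0∞} (hf : ∀ i, ∃ n : ℕ, f i = n) (h : ∑' i, f i ≠ ∞) :
    ∃ n : ℕ, ∑' i, f i = n := by
  choose g hg using hf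
  have hs : Set.Finite {i | 1 ≤ f i} := ENNReal.finite_const_le_of_tsum_ne_top h one_ne_zero
  refine ⟨∑ i ∈ hs.toFinset, g i, ?_⟩
  rw [tsum_eq_sum (s := hs.toFinset)]
  · push_cast
    exact Finset.sum_congr rfl fun i _ => hg i
  · intro i hi
    rw [hg i]
    have : ¬ (1 : ℝ≥0∞) ≤ g i := by simpa [hg i] using hi
    by_contra h0
    refine this ?_
    have : g i ≠ 0 := by simpa using h0
    exact_mod_cast Nat.one_le_iff_ne_zero.2 this

omit [MetricSpace X] in
lemma exists_nat_measure_compl {μ : Measure X} {S A : Set X} (hA : MeasurableSet A)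
    (hS : ∃ n : ℕ, μ S = n) (h : ∃ n : ℕ, μ (A ∩ S) = n) :
    ∃ n : ℕ, μ (Aᶜ ∩ S) = n := by
  obtain ⟨a, ha⟩ := h
  obtain ⟨n, hn⟩ := hS
  have hadd : μ (A ∩ S) + μ (Aᶜ ∩ S) = μ S := by
    rw [Set.inter_comm A, Set.inter_comm Aᶜ, ← Set.sdiff_eq]
    exact measure_inter_add_sdiff S hA
  rw [ha, hn] at hadd
  refine ⟨n - a, ?_⟩
  rw [ENNReal.natCast_sub, ← hadd, ENNReal.add_sub_cancel_left (ENNReal.natCast_ne_top a)]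

/-- It suffices to test integrality on the traces on the shells of a generating algebra. -/
lemma isPointMeasure_iff_of_generateFrom [OpensMeasurableSpace X] {𝒜 : Set (Set X)}
    (h𝒜 : IsSetAlgebra 𝒜) (hgen : ‹MeasurableSpace X› = MeasurableSpace.generateFrom 𝒜)
    (μ : LocFinMeasure X) :
    IsPointMeasure μ ↔ ∀ A ∈ 𝒜, ∀ k, ∃ n : ℕ, (μ : Measure X) (A ∩ shell X k) = n := by
  have hmeas : ∀ A ∈ 𝒜, MeasurableSet A := fun A hA => by
    rw [hgen]; exact MeasurableSpace.measurableSet_generateFrom hA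
  constructor
  · intro h A hA k
    exact h _ ((hmeas A hA).inter (measurableSet_shell k))
      ((isBounded_shell k).subset Set.inter_subset_right)
  · intro h
    have hS : ∀ k, ∃ n : ℕ, (μ : Measure X) (shell X k) = n := fun k => by
      simpa using h Set.univ h𝒜.univ_mem k
    -- Dynkin induction inside one shell, whose finite mass makes complements a subtraction and
    -- countable disjoint unions a convergent series.
    have key : ∀ k, ∀ A, MeasurableSet A → ∃ n : ℕ, (μ : Measure X) (A ∩ shell X k) = n := by
      intro k A hA
      induction A, hA using MeasurableSpace.induction_on_inter hgen
        h𝒜.isSetRing.isSetSemiring.isPiSystem with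
      | empty => exact ⟨0, by simp⟩
      | basic A hA => exact h A hA k
      | compl A hA ih => exact exists_nat_measure_compl hA (hS k) ih
      | iUnion f hd hf ih =>
        have e : (μ : Measure X) ((⋃ i, f i) ∩ shell X k)
            = ∑' i, (μ : Measure X) (f i ∩ shell X k) := by
          rw [Set.iUnion_inter]
          exact measure_iUnion (fun i j hij => (hd hij).mono Set.inter_subset_left
            Set.inter_subset_left) fun i => (hf i).inter (measurableSet_shell k)
        rw [e]
        refine exists_nat_tsum_eq ih ?_
        rw [← e]
        exact ((measure_mono Set.inter_subset_right).trans_lt (measure_shell_lt_top μ k)).ne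
    intro B hB hb
    obtain ⟨N, hN⟩ := exists_shellIndex_lt hb
    choose g hg using fun k => key k B hB
    refine ⟨∑ k ∈ Finset.range N, g k, ?_⟩
    rw [measure_eq_sum_shell _ hB hN]
    push_cast
    exact Finset.sum_congr rfl fun k _ => hg k

/-- A countable generating algebra turns integrality on all bounded Borel sets into countably many
measurable conditions. -/
lemma measurableSet_isPointMeasure [BorelSpace X] [SecondCountableTopology X] :
    MeasurableSet {μ : LocFinMeasure X | IsPointMeasure μ} := by
  obtain ⟨𝒜₀, hc, hgen₀⟩ := MeasurableSpace.CountablyGenerated.isCountablyGenerated (α := X)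
  have hc' := countable_generateSetAlgebra hc
  have hgen : ‹MeasurableSpace X› = MeasurableSpace.generateFrom (generateSetAlgebra 𝒜₀) := by
    rw [generateFrom_generateSetAlgebra_eq, hgen₀]
  have hmeas : ∀ A ∈ generateSetAlgebra 𝒜₀, MeasurableSet A := fun A hA => by
    rw [hgen]; exact MeasurableSpace.measurableSet_generateFrom hA
  simp_rw [isPointMeasure_iff_of_generateFrom isSetAlgebra_generateSetAlgebra hgen,
    Set.ofPred_forall, Set.ofPred_exists]
  refine MeasurableSet.biInter hc' fun A hA => MeasurableSet.iInter fun k =>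
    MeasurableSet.iUnion fun n => ?_
  exact measurable_eval ((hmeas A hA).inter (measurableSet_shell k)) (measurableSet_singleton _)

end PointMeasure

/-! ### The Pólya urn and its Campbell measure -/

section Urn

variable {X : Type*} [MetricSpace X] [MeasurableSpace X] [OpensMeasurableSpace X]

/-- The kernel `μ ↦ ρ + μ`. -/
noncomputable def addKernel (ρ : LocFinMeasure X) : Kernel (LocFinMeasure X) X :=
  (evalKernel X).comap (fun μ => ρ + μ) (measurable_const_add ρ)

instance isSFiniteKernel_addKernel (ρ : LocFinMeasure X) : IsSFiniteKernel (addKernel ρ) := by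
  unfold addKernel; infer_instance

/-- The unnormalised law of the configuration after `n` draws from the Pólya urn with initial
composition `ρ`: a new point is drawn from `ρ + μ`. -/
noncomputable def urn (ρ : LocFinMeasure X) : ℕ → Measure (LocFinMeasure X)
  | 0 => Measure.dirac 0
  | n + 1 => ((urn ρ n) ⊗ₘ (addKernel ρ)).map fun p => p.1 + unitMass p.2

instance sFinite_urn (ρ : LocFinMeasure X) (n : ℕ) : SFinite (urn ρ n) := by
  induction n with
  | zero => unfold urn; infer_instance
  | succ n ih => unfold urn; infer_instance

lemma lintegral_urn_succ (ρ : LocFinMeasure X) (n : ℕ) {F : LocFinMeasure X → ℝ≥0∞}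
    (hF : Measurable F) :
    ∫⁻ μ, F μ ∂(urn ρ (n + 1)) =
      ∫⁻ μ, ∫⁻ x, F (μ + unitMass x) ∂((ρ + μ : LocFinMeasure X) : Measure X) ∂(urn ρ n) := by
  have hm : Measurable fun p : LocFinMeasure X × X => p.1 + unitMass p.2 :=
    measurable_fst.add (measurable_unitMass.comp measurable_snd)
  rw [urn, lintegral_map hF hm]
  exact Measure.lintegral_compProd (hF.comp hm)

lemma measurable_campbell_integrand {f : X × LocFinMeasure X → ℝ≥0∞} (hf : Measurable f) :
    Measurable fun μ : LocFinMeasure X => ∫⁻ x, f (x, μ) ∂(μ : Measure X) :=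
  measurable_lintegral_coe measurable_id (hf.comp measurable_swap)

lemma measurable_papangelou_integrand (ρ : LocFinMeasure X) {f : X × LocFinMeasure X → ℝ≥0∞}
    (hf : Measurable f) :
    Measurable fun μ : LocFinMeasure X =>
      ∫⁻ x, f (x, μ + unitMass x) ∂((ρ + μ : LocFinMeasure X) : Measure X) :=
  measurable_lintegral_coe (measurable_const_add ρ)
    (f := fun μ x => f (x, μ + unitMass x))
    (hf.comp (measurable_snd.prodMk (measurable_add_unitMass.comp measurable_swap)))

omit [OpensMeasurableSpace X] in
lemma lintegral_coe_add (μ ν : LocFinMeasure X) (f : X → ℝ≥0∞) :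
    ∫⁻ x, f x ∂((μ + ν : LocFinMeasure X) : Measure X)
      = ∫⁻ x, f x ∂(μ : Measure X) + ∫⁻ x, f x ∂(ν : Measure X) := by
  rw [coe_add, lintegral_add_measure]

omit [OpensMeasurableSpace X] in
lemma lintegral_coe_add_unitMass (μ : LocFinMeasure X) (y : X) {f : X → ℝ≥0∞}
    (hf : Measurable f) :
    ∫⁻ x, f x ∂((μ + unitMass y : LocFinMeasure X) : Measure X)
      = ∫⁻ x, f x ∂(μ : Measure X) + f y := by
  rw [lintegral_coe_add, coe_unitMass, lintegral_dirac' _ hf]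

/-- Two successive draws from the urn are exchangeable. -/
lemma lintegral_draw_draw_comm (σ : LocFinMeasure X) {h : X → X → ℝ≥0∞}
    (hh : Measurable (Function.uncurry h)) :
    ∫⁻ x, ∫⁻ y, h x y ∂((σ + unitMass x : LocFinMeasure X) : Measure X) ∂(σ : Measure X)
      = ∫⁻ x, ∫⁻ y, h y x ∂((σ + unitMass x : LocFinMeasure X) : Measure X) ∂(σ : Measure X) := by
  have h1 : ∀ x, Measurable (h x) := fun x => hh.comp measurable_prodMk_left
  have h2 : ∀ x, Measurable fun y => h y x := fun x => hh.comp measurable_prodMk_right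
  have hd : Measurable fun x => h x x := hh.comp (measurable_id.prodMk measurable_id)
  simp_rw [fun x => lintegral_coe_add_unitMass σ x (h1 x),
    fun x => lintegral_coe_add_unitMass σ x (h2 x)]
  rw [lintegral_add_right _ hd, lintegral_add_right _ hd,
    lintegral_lintegral_swap hh.aemeasurable]

/-- The marked point is either the last one drawn (first term) or one of the earlier ones (second
term). -/
lemma campbell_urn_succ_aux (ρ : LocFinMeasure X) (n : ℕ) {f : X × LocFinMeasure X → ℝ≥0∞}
    (hf : Measurable f) :
    campbell (urn ρ (n + 1)) f =
      ∫⁻ μ, ∫⁻ x, f (x, μ + unitMass x) ∂((ρ + μ : LocFinMeasure X) : Measure X) ∂(urn ρ n)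
      + campbell (urn ρ n) fun p => ∫⁻ y, f (p.1, p.2 + unitMass y)
          ∂((ρ + p.2 : LocFinMeasure X) : Measure X) := by
  have hfμ : ∀ μ, Measurable fun x => f (x, μ) := fun μ => hf.comp measurable_prodMk_right
  rw [campbell, lintegral_urn_succ ρ n (measurable_campbell_integrand hf), campbell,
    ← lintegral_add_left (measurable_papangelou_integrand ρ hf)]
  refine lintegral_congr fun μ => ?_
  simp_rw [fun y => lintegral_coe_add_unitMass μ y (hfμ (μ + unitMass y))]
  have hd : Measurable fun x => f (x, μ + unitMass x) :=
    hf.comp (measurable_id.prodMk (measurable_const.add measurable_unitMass))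
  rw [lintegral_add_right _ hd, add_comm, lintegral_lintegral_swap]
  exact (hf.comp (measurable_snd.prodMk
    (measurable_const.add (measurable_unitMass.comp measurable_fst)))).aemeasurable

lemma campbell_urn_zero (ρ : LocFinMeasure X) {f : X × LocFinMeasure X → ℝ≥0∞}
    (hf : Measurable f) : campbell (urn ρ 0) f = 0 := by
  rw [campbell, urn, lintegral_dirac' _ (measurable_campbell_integrand hf)]
  exact lintegral_zero_measure _

/-- By exchangeability each of the `n + 1` drawn points contributes as much as the last one. The
induction generalizes `f` because the earlier points are handled with `f` integrated over the last
draw. -/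
lemma campbell_urn_succ (ρ : LocFinMeasure X) (n : ℕ) {f : X × LocFinMeasure X → ℝ≥0∞}
    (hf : Measurable f) :
    campbell (urn ρ (n + 1)) f = (n + 1) *
      ∫⁻ μ, ∫⁻ x, f (x, μ + unitMass x) ∂((ρ + μ : LocFinMeasure X) : Measure X) ∂(urn ρ n) := by
  have hg {f : X × LocFinMeasure X → ℝ≥0∞} (hf : Measurable f) :
      Measurable fun p : X × LocFinMeasure X => ∫⁻ y, f (p.1, p.2 + unitMass y)
        ∂((ρ + p.2 : LocFinMeasure X) : Measure X) :=
    measurable_lintegral_coe (measurable_snd.const_add ρ)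
        (f := fun (p : X × LocFinMeasure X) y => f (p.1, p.2 + unitMass y))
        (hf.comp ((measurable_fst.comp measurable_fst).prodMk
          ((measurable_snd.comp measurable_fst).add (measurable_unitMass.comp measurable_snd))))
  induction n generalizing f with
  | zero =>
    rw [campbell_urn_succ_aux ρ 0 hf]
    rw [campbell_urn_zero ρ (hg hf)]
    simp
  | succ n ih =>
    rw [campbell_urn_succ_aux ρ (n + 1) hf, ih]
    -- Swapping the last two draws makes the marked point the earlier of the two, the form produced
    -- by the induction hypothesis.
    · have key : ∫⁻ μ, ∫⁻ x, f (x, μ + unitMass x)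
            ∂((ρ + μ : LocFinMeasure X) : Measure X) ∂(urn ρ (n + 1))
          = ∫⁻ μ, ∫⁻ x, ∫⁻ y, f (x, μ + unitMass x + unitMass y)
            ∂((ρ + (μ + unitMass x) : LocFinMeasure X) : Measure X)
            ∂((ρ + μ : LocFinMeasure X) : Measure X) ∂(urn ρ n) := by
        rw [lintegral_urn_succ ρ n (measurable_papangelou_integrand ρ hf)]
        refine lintegral_congr fun μ => ?_
        simp_rw [← add_assoc]
        rw [lintegral_draw_draw_comm (ρ + μ) (h := fun x y => f (y, μ + unitMass x + unitMass y))]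
        · simp_rw [fun x y => add_right_comm μ (unitMass y) (unitMass x)]
        · exact hf.comp (measurable_snd.prodMk
            ((measurable_const.add (measurable_unitMass.comp measurable_fst)).add
              (measurable_unitMass.comp measurable_snd)))
      rw [key]
      push_cast
      ring
    · exact hg hf

lemma ae_urn_succ {ρ : LocFinMeasure X} {n : ℕ} {p q : LocFinMeasure X → Prop}
    (hq : MeasurableSet {μ | q μ}) (hp : ∀ᵐ μ ∂(urn ρ n), p μ)
    (hpq : ∀ μ x, p μ → q (μ + unitMass x)) : ∀ᵐ μ ∂(urn ρ (n + 1)), q μ := by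
  change urn ρ (n + 1) {μ | q μ}ᶜ = 0
  rw [← lintegral_indicator_one hq.compl, lintegral_urn_succ ρ n
    (measurable_one.indicator hq.compl)]
  rw [lintegral_eq_zero_iff' (measurable_lintegral_coe (measurable_const_add ρ) (f := fun μ x =>
    ({μ | q μ}ᶜ).indicator 1 (μ + unitMass x)) ((measurable_one.indicator hq.compl).comp
      (measurable_add_unitMass.comp measurable_swap))).aemeasurable]
  filter_upwards [hp] with μ hμ
  have : ∀ x, ({μ | q μ}ᶜ).indicator (1 : LocFinMeasure X → ℝ≥0∞) (μ + unitMass x) = 0 :=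
    fun x => Set.indicator_of_notMem (Set.notMem_compl_iff.2 (hpq μ x hμ)) _
  simp [this]

lemma ae_urn_measure_univ (ρ : LocFinMeasure X) (n : ℕ) :
    ∀ᵐ μ : LocFinMeasure X ∂(urn ρ n), (μ : Measure X) Set.univ = n := by
  have hm : ∀ n : ℕ, MeasurableSet {μ : LocFinMeasure X | (μ : Measure X) Set.univ = n} :=
    fun n => measurable_eval MeasurableSet.univ (measurableSet_singleton _)
  induction n with
  | zero =>
    rw [urn, ae_dirac_iff (hm 0), Nat.cast_zero]
    rfl
  | succ n ih =>
    refine ae_urn_succ (hm (n + 1)) ih fun μ x hμ => ?_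
    rw [coe_add, Measure.add_apply, hμ, coe_unitMass, measure_univ]
    push_cast
    rfl

/-- After `n` draws the urn almost surely has mass `ρ(X) + n`, so the total masses are rising
factorials. -/
lemma urn_univ (ρ : LocFinMeasure X) (n : ℕ) :
    urn ρ n Set.univ = ∏ i ∈ Finset.range n, ((ρ : Measure X) Set.univ + i) := by
  induction n with
  | zero => simp [urn]
  | succ n ih =>
    rw [Finset.prod_range_succ, ← ih, ← lintegral_one,
      lintegral_urn_succ ρ n (F := fun _ => 1) measurable_const]
    simp_rw [lintegral_one]
    rw [lintegral_congr_ae (g := fun _ => (ρ : Measure X) Set.univ + n), lintegral_const, mul_comm]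
    filter_upwards [ae_urn_measure_univ ρ n] with μ hμ
    rw [coe_add, Measure.add_apply, hμ]

end Urn

/-! ### Existence for a finite base measure -/

section FiniteExistence

variable {X : Type*} [MetricSpace X] [MeasurableSpace X] [BorelSpace X]
  [SecondCountableTopology X]

lemma ae_urn_isPointMeasure (ρ : LocFinMeasure X) (n : ℕ) :
    ∀ᵐ μ ∂(urn ρ n), IsPointMeasure μ := by
  induction n with
  | zero =>
    rw [urn, ae_dirac_iff measurableSet_isPointMeasure]
    exact isPointMeasure_zero
  | succ n ih => exact ae_urn_succ measurableSet_isPointMeasure ih fun μ x h => h.add_unitMass x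

/-- The negative binomial weights are summable. -/
lemma summable_negBinomial {z r : ℝ} (hz0 : 0 ≤ z) (hz1 : z < 1) (hr : 0 ≤ r) :
    Summable fun n : ℕ => z ^ n / n.factorial * ∏ i ∈ Finset.range n, (r + i) := by
  have h2 : (z + 1) / 2 < 1 := by linarith
  refine summable_of_ratio_norm_eventually_le h2 ?_
  -- The ratio of consecutive terms is `z (r + n) / (n + 1)`, which is at most `(z + 1) / 2` once `n
  -- (1 - z) ≥ 2 r`.
  obtain ⟨N, hN⟩ := exists_nat_ge (2 * r / (1 - z))
  filter_upwards [eventually_ge_atTop N] with n hn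
  have hpos : ∀ m : ℕ, 0 ≤ z ^ m / m.factorial * ∏ i ∈ Finset.range m, (r + i) := fun m =>
    mul_nonneg (by positivity) (Finset.prod_nonneg fun i _ => by positivity)
  rw [Real.norm_of_nonneg (hpos _), Real.norm_of_nonneg (hpos _), Finset.prod_range_succ,
    Nat.factorial_succ, pow_succ]
  have e : z ^ n * z / ((n + 1) * n.factorial : ℕ) * ((∏ i ∈ Finset.range n, (r + i)) * (r + n))
      = (z * (r + n) / (n + 1)) * (z ^ n / n.factorial * ∏ i ∈ Finset.range n, (r + i)) := by
    push_cast
    field_simp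
  rw [e]
  refine mul_le_mul_of_nonneg_right ?_ (hpos n)
  have hn' : 2 * r / (1 - z) ≤ n := hN.trans (by exact_mod_cast hn)
  rw [div_le_iff₀ (by linarith)] at hn'
  rw [div_le_iff₀ (by positivity)]
  nlinarith

/-- The unnormalised Pólya sum process of a finite measure. -/
noncomputable def urnSum (z : ℝ) (ρ : LocFinMeasure X) : Measure (LocFinMeasure X) :=
  Measure.sum fun n : ℕ => ENNReal.ofReal (z ^ n / n.factorial) • urn ρ n

omit [SecondCountableTopology X] in
-- The weights are made for the factor in `campbell_urn_succ`: `(n + 1) z ^ (n + 1) / (n + 1)! = z *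
-- (z ^ n / n!)`. The term `n = 0` drops out because the urn starts empty.
lemma campbell_urnSum {z : ℝ} (hz0 : 0 ≤ z) (ρ : LocFinMeasure X)
    {f : X × LocFinMeasure X → ℝ≥0∞} (hf : Measurable f) :
    campbell (urnSum z ρ) f = ENNReal.ofReal z * ∫⁻ μ, ∫⁻ x, f (x, μ + unitMass x)
      ∂((ρ + μ : LocFinMeasure X) : Measure X) ∂(urnSum z ρ) := by
  rw [campbell, urnSum, lintegral_sum_measure, lintegral_sum_measure,
    tsum_eq_zero_add' ENNReal.summable, ← ENNReal.tsum_mul_left]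
  simp_rw [lintegral_smul_measure]
  change _ • campbell _ _ + ∑' n, _ • campbell _ _ = _
  simp_rw [campbell_urn_succ ρ _ hf, campbell_urn_zero ρ hf, smul_zero, zero_add, smul_eq_mul]
  refine tsum_congr fun n => ?_
  rw [← mul_assoc, ← mul_assoc, ← ENNReal.ofReal_mul hz0]
  congr 1
  rw [← Nat.cast_succ, ← ENNReal.ofReal_natCast, ← ENNReal.ofReal_mul (by positivity)]
  congr 1
  rw [Nat.factorial_succ, pow_succ]
  push_cast
  field_simp

omit [SecondCountableTopology X] in
lemma urnSum_univ_ne_top {z : ℝ} (hz0 : 0 ≤ z) (hz1 : z < 1) {ρ : LocFinMeasure X}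
    (hρ : (ρ : Measure X) Set.univ ≠ ∞) : urnSum z ρ Set.univ ≠ ∞ := by
  have e : ∀ n, (ENNReal.ofReal (z ^ n / n.factorial) • urn ρ n) Set.univ
      = ENNReal.ofReal (z ^ n / n.factorial *
        ∏ i ∈ Finset.range n, (((ρ : Measure X) Set.univ).toReal + i)) := by
    intro n
    rw [Measure.smul_apply, urn_univ, smul_eq_mul, ENNReal.ofReal_mul (by positivity),
      ENNReal.ofReal_prod_of_nonneg (fun i _ => by positivity)]
    congr 1
    refine Finset.prod_congr rfl fun i _ => ?_
    rw [ENNReal.ofReal_add (by positivity) (by positivity), ENNReal.ofReal_toReal hρ,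
      ENNReal.ofReal_natCast]
  rw [urnSum, Measure.sum_apply _ MeasurableSet.univ]
  simp_rw [e]
  exact (summable_negBinomial hz0 hz1 ENNReal.toReal_nonneg).tsum_ofReal_ne_top

omit [BorelSpace X] [SecondCountableTopology X] in
lemma urnSum_univ_ne_zero (z : ℝ) (ρ : LocFinMeasure X) : urnSum z ρ Set.univ ≠ 0 := by
  rw [urnSum, Measure.sum_apply _ MeasurableSet.univ]
  intro h
  have := ENNReal.tsum_eq_zero.1 h 0
  simp [urn] at this

/-- The Papangelou identity is linear in the process, so normalizing `urnSum` preserves it. -/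
lemma exists_isPapangelou_of_finite {z : ℝ} (hz0 : 0 ≤ z) (hz1 : z < 1) {ρ : LocFinMeasure X}
    (hρ : (ρ : Measure X) Set.univ ≠ ∞) : ∃ P : Measure (LocFinMeasure X),
      IsPapangelou P fun μ => ENNReal.ofReal z • ((ρ + μ : LocFinMeasure X) : Measure X) := by
  refine ⟨(urnSum z ρ Set.univ)⁻¹ • urnSum z ρ, ⟨⟨⟨?_⟩, ?_⟩, fun f hf => ?_⟩⟩
  · rw [Measure.smul_apply, smul_eq_mul,
      ENNReal.inv_mul_cancel (urnSum_univ_ne_zero z ρ) (urnSum_univ_ne_top hz0 hz1 hρ)]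
  · refine Measure.ae_smul_measure ?_ _
    rw [urnSum, Measure.ae_sum_iff' measurableSet_isPointMeasure]
    exact fun n => Measure.ae_smul_measure (ae_urn_isPointMeasure ρ n) _
  · have := campbell_urnSum hz0 ρ hf
    rw [campbell] at this
    simp_rw [campbell, lintegral_smul_measure, this, smul_eq_mul]
    rw [lintegral_const_mul _ (measurable_papangelou_integrand ρ hf)]

end FiniteExistence

/-! ### Resampling one coordinate of a product measure -/

lemma measurable_update_prod {ι : Type*} [DecidableEq ι] {E : ι → Type*}
    [∀ i, MeasurableSpace (E i)] (k : ι) :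
    Measurable fun p : (∀ i, E i) × E k => Function.update p.1 k p.2 := by
  refine measurable_pi_iff.2 fun i => ?_
  by_cases h : i = k
  · subst h
    simpa using measurable_snd
  · simp only [Function.update_of_ne h]
    exact (measurable_pi_apply i).comp measurable_fst

/-- Independently resampling one coordinate preserves a product measure. -/
lemma map_update_infinitePi {ι : Type*} [DecidableEq ι] {E : ι → Type*}
    [∀ i, MeasurableSpace (E i)] (P : ∀ i, Measure (E i)) [∀ i, IsProbabilityMeasure (P i)]
    (k : ι) :
    ((Measure.infinitePi P).prod (P k)).map (fun p => Function.update p.1 k p.2)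
      = Measure.infinitePi P := by
  refine Measure.eq_infinitePi _ fun s t ht => ?_
  rw [Measure.map_apply (measurable_update_prod k) (MeasurableSet.pi s.countable_toSet fun i _ => ht i)]
  by_cases hk : k ∈ s
  · have e : (fun p : (∀ i, E i) × E k => Function.update p.1 k p.2) ⁻¹' (Set.pi s t)
        = (Set.pi (s.erase k : Finset ι) t) ×ˢ t k := by
      ext p
      simp only [Set.mem_preimage, Set.mem_pi, Set.mem_prod, Finset.mem_coe, Finset.mem_erase]
      constructor
      · intro h
        exact ⟨fun i hi => by simpa [hi.1] using h i hi.2, by simpa using h k hk⟩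
      · rintro ⟨h1, h2⟩ i hi
        by_cases h : i = k
        · subst h; simpa using h2
        · simpa [h] using h1 i ⟨h, hi⟩
    rw [e, Measure.prod_prod, Measure.infinitePi_pi _ fun i _ => ht i,
      Finset.prod_erase_mul _ _ hk]
  · have e : (fun p : (∀ i, E i) × E k => Function.update p.1 k p.2) ⁻¹' (Set.pi s t)
        = (Set.pi s t) ×ˢ Set.univ := by
      ext p
      simp only [Set.mem_preimage, Set.mem_pi, Set.mem_prod, Finset.mem_coe, Set.mem_univ,
        and_true]
      refine forall₂_congr fun i hi => ?_
      rw [Function.update_of_ne (ne_of_mem_of_not_mem hi hk)]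
    rw [e, Measure.prod_prod, Measure.infinitePi_pi _ fun i _ => ht i, measure_univ, mul_one]

lemma lintegral_infinitePi_update {ι α : Type*} [DecidableEq ι] [MeasurableSpace α]
    (P : ι → Measure α) [∀ i, IsProbabilityMeasure (P i)] (k : ι)
    {F : (ι → α) → ℝ≥0∞} (hF : Measurable F) :
    ∫⁻ m, F m ∂(Measure.infinitePi P)
      = ∫⁻ m, ∫⁻ a, F (Function.update m k a) ∂(P k) ∂(Measure.infinitePi P) := by
  conv_lhs => rw [← map_update_infinitePi P k]
  rw [lintegral_map hF (measurable_update_prod k)]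
  exact lintegral_prod _ (hF.comp (measurable_update_prod k)).aemeasurable

/-! ### Gluing measures along the shells -/

section Glue

variable {X : Type*} [MetricSpace X] [MeasurableSpace X] [OpensMeasurableSpace X]

/-- The restriction of a locally finite measure to a shell. -/
noncomputable def restrictShell (k : ℕ) (μ : LocFinMeasure X) : LocFinMeasure X :=
  ⟨(μ : Measure X).restrict (shell X k), fun B hB hb =>
    (Measure.restrict_apply_le _ _).trans_lt (μ.2 B hB hb)⟩

/-- The locally finite measure which coincides with `m k` on the `k`-th shell. -/
noncomputable def glue (m : ℕ → LocFinMeasure X) : LocFinMeasure X :=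
  ⟨Measure.sum fun k => (m k : Measure X).restrict (shell X k), mem_locFin_of_shell fun j => by
    rw [Measure.sum_apply _ (measurableSet_shell j), tsum_eq_single j]
    · rw [Measure.restrict_apply (measurableSet_shell j), Set.inter_self]
      exact measure_shell_lt_top (m j) j
    · intro k hk
      rw [Measure.restrict_apply (measurableSet_shell j),
        (pairwise_disjoint_shell hk.symm).inter_eq, measure_empty]⟩

lemma glue_apply (m : ℕ → LocFinMeasure X) {B : Set X} (hB : MeasurableSet B) :
    (glue m : Measure X) B = ∑' k, (m k : Measure X) (B ∩ shell X k) := by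
  change (Measure.sum fun k => (m k : Measure X).restrict (shell X k)) B = _
  rw [Measure.sum_apply _ hB]
  exact tsum_congr fun k => Measure.restrict_apply hB

lemma measurable_glue : Measurable (glue : (ℕ → LocFinMeasure X) → LocFinMeasure X) := by
  refine Measurable.subtype_mk (Measure.measurable_of_measurable_coe _ fun B hB => ?_)
  change Measurable fun m : ℕ → LocFinMeasure X => (glue m : Measure X) B
  simp_rw [glue_apply _ hB]
  exact Measurable.tsum fun k =>
    (measurable_eval (hB.inter (measurableSet_shell k))).comp (measurable_pi_apply k)

lemma glue_restrict_shell (m : ℕ → LocFinMeasure X) (k : ℕ) :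
    (glue m : Measure X).restrict (shell X k) = (m k : Measure X).restrict (shell X k) := by
  ext B hB
  rw [Measure.restrict_apply hB, Measure.restrict_apply hB,
    glue_apply m (hB.inter (measurableSet_shell k)), tsum_eq_single k]
  · rw [Set.inter_assoc, Set.inter_self]
  · intro j hj
    rw [Set.inter_assoc, (pairwise_disjoint_shell hj.symm).inter_eq, Set.inter_empty,
      measure_empty]

lemma glue_update_add_unitMass (m : ℕ → LocFinMeasure X) {k : ℕ} (μ : LocFinMeasure X) {x : X}
    (hx : x ∈ shell X k) :
    glue (Function.update m k (μ + unitMass x)) = glue (Function.update m k μ) + unitMass x := by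
  refine Subtype.ext (Measure.ext fun B hB => ?_)
  rw [coe_add, Measure.add_apply, glue_apply _ hB, glue_apply _ hB, coe_unitMass,
    measure_eq_tsum_shell (Measure.dirac x) hB, ← ENNReal.tsum_add]
  refine tsum_congr fun j => ?_
  by_cases hj : j = k
  · subst hj
    rw [Function.update_self, Function.update_self, coe_add, Measure.add_apply, coe_unitMass]
  · have : x ∉ B ∩ shell X j := fun h => hj
      ((show shellIndex x = j from h.2).symm.trans hx)
    rw [Function.update_of_ne hj, Function.update_of_ne hj,
      Measure.dirac_apply' _ (hB.inter (measurableSet_shell j)), Set.indicator_of_notMem this,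
      add_zero]

lemma lintegral_eq_tsum_shell (μ : Measure X) (f : X → ℝ≥0∞) :
    ∫⁻ x, f x ∂μ = ∑' k, ∫⁻ x in shell X k, f x ∂μ := by
  rw [← lintegral_iUnion measurableSet_shell pairwise_disjoint_shell, iUnion_shell,
    Measure.restrict_univ]

lemma isPointMeasure_glue {m : ℕ → LocFinMeasure X} (h : ∀ k, IsPointMeasure (m k)) :
    IsPointMeasure (glue m) := by
  intro B hB hb
  obtain ⟨N, hN⟩ := exists_shellIndex_lt hb
  choose g hg using fun k => h k _ (hB.inter (measurableSet_shell k))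
    (hb.subset Set.inter_subset_left)
  refine ⟨∑ k ∈ Finset.range N, g k, ?_⟩
  rw [measure_eq_sum_shell _ hB hN]
  push_cast
  refine Finset.sum_congr rfl fun k _ => ?_
  rw [← hg k, ← Measure.restrict_apply hB, glue_restrict_shell, Measure.restrict_apply hB]

end Glue

/-! ### Existence for a locally finite base measure -/

section Existence

variable {X : Type*} [MetricSpace X] [MeasurableSpace X] [BorelSpace X]
  [SecondCountableTopology X]

/-- The Pólya sum process exists for every locally finite measure. -/
theorem exists_isPapangelou {z : ℝ} (hz0 : 0 ≤ z) (hz1 : z < 1) (ρ : LocFinMeasure X) :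
    ∃ P : Measure (LocFinMeasure X),
      IsPapangelou P fun μ => ENNReal.ofReal z • ((ρ + μ : LocFinMeasure X) : Measure X) := by
  have hfin : ∀ k, (restrictShell k ρ : Measure X) Set.univ ≠ ∞ := fun k => by
    change (ρ : Measure X).restrict (shell X k) Set.univ ≠ ∞
    rw [Measure.restrict_apply_univ]
    exact (measure_shell_lt_top ρ k).ne
  choose P hP using fun k => exists_isPapangelou_of_finite hz0 hz1 (hfin k)
  have : ∀ k, IsProbabilityMeasure (P k) := fun k => (IsPapangelou.isPointProcess (hP k)).isProbabilityMeasure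
  refine ⟨(Measure.infinitePi P).map glue,
    ⟨⟨Measure.isProbabilityMeasure_map measurable_glue.aemeasurable, ?_⟩, fun f hf => ?_⟩⟩
  · rw [ae_map_iff measurable_glue.aemeasurable measurableSet_isPointMeasure]
    have : ∀ᵐ m ∂(Measure.infinitePi P), ∀ k, IsPointMeasure (m k) := ae_all_iff.2 fun k => by
      have h := (measurePreserving_eval_infinitePi P k).quasiMeasurePreserving.ae
        (IsPapangelou.isPointProcess (hP k)).ae_isPointMeasure
      exact h
    filter_upwards [this] with m hm using isPointMeasure_glue hm
  have hfg : ∀ k, Measurable fun p : (ℕ → LocFinMeasure X) × X =>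
      (shell X k).indicator (fun x => f (x, glue p.1)) p.2 := fun k => by
    have h1 : Measurable fun p : (ℕ → LocFinMeasure X) × X => f (p.2, glue p.1) :=
      hf.comp (measurable_snd.prodMk (measurable_glue.comp measurable_fst))
    exact h1.indicator (measurable_snd (measurableSet_shell k))
  have hfg' : ∀ k, Measurable fun p : (ℕ → LocFinMeasure X) × X =>
      (shell X k).indicator (fun x => f (x, glue p.1 + unitMass x)) p.2 := fun k => by
    have h1 : Measurable fun p : (ℕ → LocFinMeasure X) × X => f (p.2, glue p.1 + unitMass p.2) :=
      hf.comp (measurable_snd.prodMk ((measurable_glue.comp measurable_fst).add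
        (measurable_unitMass.comp measurable_snd)))
    exact h1.indicator (measurable_snd (measurableSet_shell k))
  have hL : ∀ k, Measurable fun m : ℕ → LocFinMeasure X =>
      ∫⁻ x, (shell X k).indicator (fun x => f (x, glue m)) x ∂(m k : Measure X) := fun k =>
    measurable_lintegral_coe (measurable_pi_apply k) (hfg k)
  have hR : ∀ k, Measurable fun m : ℕ → LocFinMeasure X =>
      ∫⁻ x, (shell X k).indicator (fun x => f (x, glue m + unitMass x)) x
        ∂((restrictShell k ρ + m k : LocFinMeasure X) : Measure X) := fun k =>
    measurable_lintegral_coe ((measurable_pi_apply k).const_add _) (hfg' k)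
  have hshell : ∀ k, ∫⁻ m, ∫⁻ x, (shell X k).indicator (fun x => f (x, glue m)) x
        ∂(m k : Measure X) ∂(Measure.infinitePi P)
      = ENNReal.ofReal z * ∫⁻ m, ∫⁻ x, (shell X k).indicator (fun x => f (x, glue m + unitMass x)) x
        ∂((restrictShell k ρ + m k : LocFinMeasure X) : Measure X) ∂(Measure.infinitePi P) := by
    intro k
    rw [lintegral_infinitePi_update P k (hL k), lintegral_infinitePi_update P k (hR k),
      ← lintegral_const_mul]
    · refine lintegral_congr fun m => ?_
      have hm : Measurable fun p : X × LocFinMeasure X => (Function.update m k p.2, p.1) :=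
        ((measurable_update m).comp measurable_snd).prodMk measurable_fst
      -- With all other coordinates frozen at `m`, the identity for `P k` applies to the resampled
      -- coordinate alone.
      have := (hP k).campbell_eq _ ((hfg k).comp hm)
      simp only [campbell, lintegral_smul_measure, smul_eq_mul, Function.comp_apply] at this
      simp_rw [Function.update_self]
      rw [this, lintegral_const_mul]
      · congr 1
        refine lintegral_congr fun μ => lintegral_congr fun x => ?_
        by_cases hx : x ∈ shell X k
        · rw [Set.indicator_of_mem hx, Set.indicator_of_mem hx, glue_update_add_unitMass m μ hx]
        · rw [Set.indicator_of_notMem hx, Set.indicator_of_notMem hx]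
      · exact measurable_papangelou_integrand _ ((hfg k).comp hm)
    · exact Measurable.lintegral_prod_right' ((hR k).comp (measurable_update_prod k))
  rw [campbell, lintegral_map (measurable_campbell_integrand hf) measurable_glue]
  simp only [lintegral_smul_measure, smul_eq_mul]
  rw [lintegral_map ((measurable_papangelou_integrand ρ hf).const_mul _) measurable_glue,
    lintegral_const_mul (ENNReal.ofReal z)
      (f := fun m => ∫⁻ x, f (x, glue m + unitMass x) ∂((ρ + glue m : LocFinMeasure X) : Measure X))
      ((measurable_papangelou_integrand ρ hf).comp measurable_glue)]
  have e1 : ∀ m : ℕ → LocFinMeasure X, ∫⁻ x, f (x, glue m) ∂(glue m : Measure X)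
      = ∑' k, ∫⁻ x, (shell X k).indicator (fun x => f (x, glue m)) x ∂(m k : Measure X) := by
    intro m
    rw [lintegral_eq_tsum_shell]
    refine tsum_congr fun k => ?_
    rw [glue_restrict_shell, lintegral_indicator (measurableSet_shell k)]
  have e2 : ∀ m : ℕ → LocFinMeasure X,
      ∫⁻ x, f (x, glue m + unitMass x) ∂((ρ + glue m : LocFinMeasure X) : Measure X)
      = ∑' k, ∫⁻ x, (shell X k).indicator (fun x => f (x, glue m + unitMass x)) x
        ∂((restrictShell k ρ + m k : LocFinMeasure X) : Measure X) := by
    intro m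
    rw [lintegral_eq_tsum_shell]
    refine tsum_congr fun k => ?_
    rw [lintegral_indicator (measurableSet_shell k), coe_add, coe_add, Measure.restrict_add,
      Measure.restrict_add, glue_restrict_shell]
    congr 2
    exact (Measure.restrict_restrict_of_subset subset_rfl).symm
  simp_rw [e1, e2]
  rw [lintegral_tsum fun k => (hL k).aemeasurable, lintegral_tsum fun k => (hR k).aemeasurable,
    ← ENNReal.tsum_mul_left]
  exact tsum_congr hshell

end Existence

/-! ### The local σ-field of a set -/

section Local

variable {X : Type*} [MetricSpace X] [MeasurableSpace X]

lemma measurable_localSigma_eval {B B' : Set X} (hB' : MeasurableSet B') (h : B' ⊆ B) :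
    Measurable[localSigma B] fun μ : LocFinMeasure X => (μ : Measure X) B' :=
  Measurable.of_comap_le <| le_iSup_of_le B' <| le_iSup_of_le hB' <| le_iSup_of_le h le_rfl

lemma measurable_localSigma_of_eval {α : Type*} {mα : MeasurableSpace α} {B : Set X}
    {g : α → LocFinMeasure X}
    (h : ∀ B', MeasurableSet B' → B' ⊆ B → Measurable fun a => (g a : Measure X) B') :
    Measurable[mα, localSigma B] g := by
  refine Measurable.of_le_map <| iSup_le fun B' => iSup_le fun hB' => iSup_le fun hs => ?_
  rw [MeasurableSpace.comap_le_iff_le_map, MeasurableSpace.map_comp]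
  exact measurable_iff_le_map.1 (h B' hB' hs)

lemma localSigma_le (B : Set X) :
    localSigma B ≤ (inferInstance : MeasurableSpace (LocFinMeasure X)) :=
  iSup_le fun _ => iSup_le fun hB' => iSup_le fun _ => (measurable_eval hB').comap_le

/-- Two measures with the same trace on `B` are not separated by `localSigma B`. -/
lemma mem_iff_of_eval_eq {B : Set X} {μ μ' : LocFinMeasure X}
    (h : ∀ B', MeasurableSet B' → B' ⊆ B → (μ : Measure X) B' = (μ' : Measure X) B')
    {S : Set (LocFinMeasure X)} (hS : MeasurableSet[localSigma B] S) : μ ∈ S ↔ μ' ∈ S := by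
  -- With the full power set on the codomain, the pulled-back σ-field consists of all preimages
  -- under `g`. It contains `localSigma B` and cannot separate points with equal `g`, and no
  -- countability is needed.
  let g : LocFinMeasure X → {B' : Set X // MeasurableSet B' ∧ B' ⊆ B} → ℝ≥0∞ :=
    fun μ B' => (μ : Measure X) B'
  have hg : Measurable[MeasurableSpace.comap g ⊤, localSigma B] id :=
    measurable_localSigma_of_eval fun B' hB' hs => by
      refine measurable_iff_comap_le.2 ?_
      rintro _ ⟨T, -, rfl⟩
      exact ⟨{u | u ⟨B', hB', hs⟩ ∈ T}, trivial, rfl⟩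
  obtain ⟨T, -, hT⟩ := hg hS
  have e : g μ = g μ' := funext fun B' => h B' B'.2.1 B'.2.2
  change μ ∈ id ⁻¹' S ↔ μ' ∈ id ⁻¹' S
  rw [← hT, Set.mem_preimage, Set.mem_preimage, e]

lemma eq_of_eval_eq {B : Set X} {μ μ' : LocFinMeasure X}
    (h : ∀ B', MeasurableSet B' → B' ⊆ B → (μ : Measure X) B' = (μ' : Measure X) B')
    {φ : LocFinMeasure X → ℝ} (hφ : Measurable[localSigma B] φ) : φ μ = φ μ' :=
  ((mem_iff_of_eval_eq h (hφ (measurableSet_singleton (φ μ)))).1 rfl).symm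

lemma add_eval_of_null {B : Set X} {μ ν : LocFinMeasure X} (h : (μ : Measure X) B = 0)
    {B' : Set X} (hs : B' ⊆ B) :
    ((μ + ν : LocFinMeasure X) : Measure X) B' = (ν : Measure X) B' := by
  rw [coe_add, Measure.add_apply, measure_mono_null hs h, zero_add]

lemma unitMass_apply_of_notMem {B : Set X} (hB : MeasurableSet B) {x : X} (hx : x ∉ B) :
    (unitMass x : Measure X) B = 0 := by
  rw [coe_unitMass, Measure.dirac_apply' _ hB, Set.indicator_of_notMem hx]

lemma add_unitMass_apply_of_mem {B : Set X} (μ : LocFinMeasure X) {x : X}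
    (hx : x ∈ B) : ((μ + unitMass x : LocFinMeasure X) : Measure X) B = (μ : Measure X) B + 1 := by
  rw [coe_add, Measure.add_apply, coe_unitMass, Measure.dirac_apply_of_mem hx]

end Local

/-! ### First-order expansion for small parameter -/

section SmallParameter

variable {X : Type*} [MetricSpace X] [MeasurableSpace X] [OpensMeasurableSpace X]
  {P : Measure (LocFinMeasure X)} {z : ℝ} {σ : LocFinMeasure X} {B : Set X}

/-- The Papangelou identity for functions `1_B(x) g(μ)`. -/
lemma IsPapangelou.lintegral_mul_eval
    (hP : IsPapangelou P fun μ => ENNReal.ofReal z • ((σ + μ : LocFinMeasure X) : Measure X))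
    (hB : MeasurableSet B) {g : LocFinMeasure X → ℝ≥0∞} (hg : Measurable g) :
    ∫⁻ μ, g μ * (μ : Measure X) B ∂P = ENNReal.ofReal z *
      ∫⁻ μ, ∫⁻ x in B, g (μ + unitMass x) ∂((σ + μ : LocFinMeasure X) : Measure X) ∂P := by
  have hf : Measurable fun p : X × LocFinMeasure X => B.indicator (fun _ => g p.2) p.1 :=
    (hg.comp measurable_snd).indicator (measurable_fst hB)
  have := hP.campbell_eq _ hf
  simp only [campbell, lintegral_smul_measure, smul_eq_mul] at this
  rw [lintegral_const_mul _ (measurable_papangelou_integrand σ hf)] at this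
  simp_rw [lintegral_indicator hB, lintegral_const, Measure.restrict_apply_univ] at this
  rw [this]
  congr 1
  refine lintegral_congr fun μ => ?_
  rw [← lintegral_indicator hB]
  refine lintegral_congr fun x => ?_
  by_cases hx : x ∈ B
  · rw [Set.indicator_of_mem hx, Set.indicator_of_mem hx]
  · rw [Set.indicator_of_notMem hx, Set.indicator_of_notMem hx]

/-- Test the identity with `1_{N ≥ c} / N`, where `N` is the mass of `B`. An added point turns `N`
into `N + 1`, and `(σ(B) + N) / (N + 1) ≤ σ(B) + 1`. Each use gains a factor `z` while lowering the
threshold by one. -/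
lemma IsPapangelou.measure_le_eval
    (hP : IsPapangelou P fun μ => ENNReal.ofReal z • ((σ + μ : LocFinMeasure X) : Measure X))
    (hB : MeasurableSet B) (hb : Bornology.IsBounded B) {c : ℝ≥0∞} (hc : 1 ≤ c) :
    P {μ | c ≤ (μ : Measure X) B} ≤
      ENNReal.ofReal z * ((σ : Measure X) B + 1) * P {μ | c ≤ (μ : Measure X) B + 1} := by
  have hN := measurable_eval (X := X) hB
  have hS : MeasurableSet {μ : LocFinMeasure X | c ≤ (μ : Measure X) B} :=
    measurableSet_le measurable_const hN
  have hS' : MeasurableSet {μ : LocFinMeasure X | c ≤ (μ : Measure X) B + 1} :=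
    measurableSet_le measurable_const (hN.add_const 1)
  have h := hP.lintegral_mul_eval hB
    (g := {μ : LocFinMeasure X | c ≤ (μ : Measure X) B}.indicator fun μ => ((μ : Measure X) B)⁻¹)
    (hN.inv.indicator hS)
  have e : ∫⁻ μ, {μ : LocFinMeasure X | c ≤ (μ : Measure X) B}.indicator
        (fun μ => ((μ : Measure X) B)⁻¹) μ * (μ : Measure X) B ∂P
      = P {μ | c ≤ (μ : Measure X) B} := by
    rw [← lintegral_indicator_one hS]
    refine lintegral_congr fun μ => ?_
    by_cases hμ : c ≤ (μ : Measure X) B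
    · rw [Set.indicator_of_mem (by exact hμ), Set.indicator_of_mem (by exact hμ),
        ENNReal.inv_mul_cancel (zero_lt_one.trans_le (hc.trans hμ)).ne' (μ.2 B hB hb).ne]
      rfl
    · rw [Set.indicator_of_notMem (by exact hμ), Set.indicator_of_notMem (by exact hμ), zero_mul]
  rw [← e, h, mul_assoc, ← lintegral_indicator_one hS', ← lintegral_const_mul _
    (measurable_one.indicator hS')]
  gcongr with μ
  have e2 : ∀ x ∈ B, {μ : LocFinMeasure X | c ≤ (μ : Measure X) B}.indicator
        (fun μ => ((μ : Measure X) B)⁻¹) (μ + unitMass x)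
      = {μ : LocFinMeasure X | c ≤ (μ : Measure X) B + 1}.indicator 1 μ
        * ((μ : Measure X) B + 1)⁻¹ := by
    have hiff : ∀ x ∈ B, μ + unitMass x ∈ {μ : LocFinMeasure X | c ≤ (μ : Measure X) B}
        ↔ c ≤ (μ : Measure X) B + 1 := fun x hx => by
      rw [← add_unitMass_apply_of_mem μ hx]
      rfl
    intro x hx
    by_cases hμ : c ≤ (μ : Measure X) B + 1
    · rw [Set.indicator_of_mem ((hiff x hx).2 hμ),
        Set.indicator_of_mem (by exact hμ), add_unitMass_apply_of_mem μ hx, Pi.one_apply, one_mul]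
    · rw [Set.indicator_of_notMem (fun h => hμ ((hiff x hx).1 h)),
        Set.indicator_of_notMem (by exact hμ), zero_mul]
  rw [setLIntegral_congr_fun hB e2, setLIntegral_const, coe_add, Measure.add_apply, mul_assoc,
    mul_comm]
  gcongr
  rw [mul_comm, ← div_eq_mul_inv]
  refine ENNReal.div_le_of_le_mul ?_
  calc (σ : Measure X) B + (μ : Measure X) B
      ≤ ((σ : Measure X) B + (μ : Measure X) B) + ((σ : Measure X) B * (μ : Measure X) B + 1) :=
        le_self_add
    _ = ((σ : Measure X) B + 1) * ((μ : Measure X) B + 1) := by ring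

lemma IsPapangelou.measure_one_le
    (hP : IsPapangelou P fun μ => ENNReal.ofReal z • ((σ + μ : LocFinMeasure X) : Measure X))
    (hB : MeasurableSet B) (hb : Bornology.IsBounded B) :
    P {μ | 1 ≤ (μ : Measure X) B} ≤ ENNReal.ofReal z * ((σ : Measure X) B + 1) := by
  have := hP.isPointProcess.isProbabilityMeasure
  exact (hP.measure_le_eval hB hb le_rfl).trans (mul_le_of_le_one_right' prob_le_one)

lemma IsPapangelou.measure_two_le
    (hP : IsPapangelou P fun μ => ENNReal.ofReal z • ((σ + μ : LocFinMeasure X) : Measure X))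
    (hB : MeasurableSet B) (hb : Bornology.IsBounded B) :
    P {μ | 2 ≤ (μ : Measure X) B} ≤ (ENNReal.ofReal z * ((σ : Measure X) B + 1)) ^ 2 := by
  refine (hP.measure_le_eval hB hb one_le_two).trans ?_
  rw [sq]
  gcongr
  refine le_trans (measure_mono fun μ hμ => ?_) (hP.measure_one_le hB hb)
  have h2 : (1 : ℝ≥0∞) + 1 ≤ (μ : Measure X) B + 1 := by
    rw [one_add_one_eq_two]; exact hμ
  exact (ENNReal.add_le_add_iff_right ENNReal.one_ne_top).1 h2

/-- On the event of a single point in `B`, the trace of the process on `B` is the unit mass at a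
`σ`-distributed point. -/
lemma IsPapangelou.measure_eval_eq_one_inter
    (hP : IsPapangelou P fun μ => ENNReal.ofReal z • ((σ + μ : LocFinMeasure X) : Measure X))
    (hB : MeasurableSet B) {S : Set (LocFinMeasure X)}
    (hS : MeasurableSet[localSigma B] S) :
    P (S ∩ {μ | (μ : Measure X) B = 1}) = ENNReal.ofReal z * P {μ | (μ : Measure X) B = 0} *
      (σ : Measure X).restrict B (unitMass ⁻¹' S) := by
  have hN := measurable_eval (X := X) hB
  have hS' := localSigma_le B _ hS
  have h1 : MeasurableSet (S ∩ {μ : LocFinMeasure X | (μ : Measure X) B = 1}) :=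
    hS'.inter (hN (measurableSet_singleton _))
  have h0 : MeasurableSet {μ : LocFinMeasure X | (μ : Measure X) B = 0} :=
    hN (measurableSet_singleton _)
  have h := hP.lintegral_mul_eval hB (measurable_one.indicator h1)
  have e : ∫⁻ μ, (S ∩ {μ : LocFinMeasure X | (μ : Measure X) B = 1}).indicator 1 μ
      * (μ : Measure X) B ∂P = P (S ∩ {μ | (μ : Measure X) B = 1}) := by
    rw [← lintegral_indicator_one h1]
    refine lintegral_congr fun μ => ?_
    by_cases hμ : μ ∈ S ∩ {μ : LocFinMeasure X | (μ : Measure X) B = 1}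
    · rw [Set.indicator_of_mem hμ, hμ.2, mul_one]
    · rw [Set.indicator_of_notMem hμ, zero_mul]
  rw [← e, h, mul_assoc, mul_comm (P _), ← lintegral_indicator_const h0]
  congr 1
  refine lintegral_congr fun μ => ?_
  -- Adding a point of `B` leads to mass exactly `1` only from mass `0`; there `μ` vanishes on `B`,
  -- so only `σ` supplies the new point.
  by_cases hμ : (μ : Measure X) B = 0
  · rw [Set.indicator_of_mem (by exact hμ), coe_add, Measure.restrict_add,
      Measure.restrict_eq_zero.2 hμ, add_zero, ← lintegral_indicator_one (measurable_unitMass hS')]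
    refine setLIntegral_congr_fun hB fun x hx => ?_
    have hmem : μ + unitMass x ∈ S ∩ {μ : LocFinMeasure X | (μ : Measure X) B = 1}
        ↔ x ∈ unitMass ⁻¹' S := by
      rw [Set.mem_inter_iff, mem_iff_of_eval_eq (fun B' _ hs => add_eval_of_null hμ hs) hS,
        Set.mem_preimage, and_iff_left]
      change ((μ + unitMass x : LocFinMeasure X) : Measure X) B = 1
      rw [add_unitMass_apply_of_mem μ hx, hμ, zero_add]
    by_cases hx' : x ∈ unitMass ⁻¹' S
    · rw [Set.indicator_of_mem (hmem.2 hx'), Set.indicator_of_mem hx']; rfl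
    · rw [Set.indicator_of_notMem (fun h => hx' (hmem.1 h)), Set.indicator_of_notMem hx']
  · rw [Set.indicator_of_notMem (by exact hμ), setLIntegral_congr_fun (g := fun _ => 0) hB]
    · exact lintegral_zero
    · intro x hx
      refine Set.indicator_of_notMem (fun hmem => hμ ?_) _
      have : (μ : Measure X) B + 1 = 0 + 1 := by
        rw [← add_unitMass_apply_of_mem μ hx, zero_add]; exact hmem.2
      exact (ENNReal.add_left_inj ENNReal.one_ne_top).1 this

lemma IsPapangelou.setIntegral_eval_eq_one
    (hP : IsPapangelou P fun μ => ENNReal.ofReal z • ((σ + μ : LocFinMeasure X) : Measure X))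
    (hz : 0 ≤ z) (hB : MeasurableSet B) {ψ : LocFinMeasure X → ℝ}
    (hψ : Measurable[localSigma B] ψ) :
    ∫ μ in {μ | (μ : Measure X) B = 1}, ψ μ ∂P =
      z * P.real {μ | (μ : Measure X) B = 0} * ∫ x in B, ψ (unitMass x) ∂(σ : Measure X) := by
  have hψ' : Measurable ψ := hψ.mono (localSigma_le B) le_rfl
  -- The law on the one-point event is identified only on `localSigma B`, so both integrals pass
  -- through the trimmed measures.
  rw [integral_trim (localSigma_le B) hψ.stronglyMeasurable]
  have e : (P.restrict {μ | (μ : Measure X) B = 1}).trim (localSigma_le B)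
      = ((ENNReal.ofReal z * P {μ | (μ : Measure X) B = 0}) •
        ((σ : Measure X).restrict B).map unitMass).trim (localSigma_le B) := by
    refine @Measure.ext _ (localSigma B) _ _ fun S hS => ?_
    have hS' := localSigma_le B _ hS
    rw [trim_measurableSet_eq _ hS, trim_measurableSet_eq _ hS, Measure.restrict_apply hS',
      Measure.smul_apply, Measure.map_apply measurable_unitMass hS', smul_eq_mul]
    exact hP.measure_eval_eq_one_inter hB hS
  rw [e, ← integral_trim (localSigma_le B) hψ.stronglyMeasurable, integral_smul_measure,
    integral_map measurable_unitMass.aemeasurable hψ'.aestronglyMeasurable, ENNReal.toReal_mul,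
    ENNReal.toReal_ofReal hz]
  rfl

/-- First order expansion of the Pólya sum process in its parameter. -/
lemma IsPapangelou.abs_integral_sub_le
    (hP : IsPapangelou P fun μ => ENNReal.ofReal z • ((σ + μ : LocFinMeasure X) : Measure X))
    (hz : 0 ≤ z) (hB : MeasurableSet B) (hb : Bornology.IsBounded B) {ψ : LocFinMeasure X → ℝ}
    (hψ : Measurable[localSigma B] ψ) (hψ0 : ψ 0 = 0) {C : ℝ} (hC : ∀ μ, |ψ μ| ≤ C) :
    |∫ μ, ψ μ ∂P - z * ∫ x in B, ψ (unitMass x) ∂(σ : Measure X)|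
      ≤ 2 * C * ((σ : Measure X).real B + 1) ^ 2 * z ^ 2 := by
  have hprob := hP.isPointProcess.isProbabilityMeasure
  have hψ' : Measurable ψ := hψ.mono (localSigma_le B) le_rfl
  have hN := measurable_eval (X := X) hB
  have h1 : MeasurableSet {μ : LocFinMeasure X | (μ : Measure X) B = 1} :=
    hN (measurableSet_singleton _)
  have h2 : MeasurableSet {μ : LocFinMeasure X | 2 ≤ (μ : Measure X) B} :=
    measurableSet_le measurable_const hN
  have h0 : MeasurableSet {μ : LocFinMeasure X | (μ : Measure X) B = 0} :=
    hN (measurableSet_singleton _)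
  have hσ : (σ : Measure X) B < ∞ := σ.2 B hB hb
  have hC0 : 0 ≤ C := (abs_nonneg _).trans (hC 0)
  set r := (σ : Measure X).real B with hr
  have hr0 : 0 ≤ r := measureReal_nonneg
  have hint : Integrable ψ P := Integrable.of_bound hψ'.aestronglyMeasurable C
    (Eventually.of_forall hC)
  have hofReal : ENNReal.ofReal z * ((σ : Measure X) B + 1) = ENNReal.ofReal (z * (r + 1)) := by
    rw [ENNReal.ofReal_mul hz, ENNReal.ofReal_add hr0 zero_le_one, ENNReal.ofReal_one, hr,
      ofReal_measureReal hσ.ne]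
  have hp2 : P.real {μ | 2 ≤ (μ : Measure X) B} ≤ (z * (r + 1)) ^ 2 := by
    refine ENNReal.toReal_le_of_le_ofReal (by positivity) ?_
    rw [ENNReal.ofReal_pow (by positivity), ← hofReal]
    exact hP.measure_two_le hB hb
  have hp1 : P.real {μ | 1 ≤ (μ : Measure X) B} ≤ z * (r + 1) := by
    refine ENNReal.toReal_le_of_le_ofReal (by positivity) ?_
    rw [← hofReal]
    exact hP.measure_one_le hB hb
  have hae : ∀ᵐ μ : LocFinMeasure X ∂P, ∃ n : ℕ, (μ : Measure X) B = n := by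
    filter_upwards [hP.isPointProcess.ae_isPointMeasure] with μ hμ using hμ B hB hb
  have hp0 : 1 - P.real {μ | (μ : Measure X) B = 0} ≤ z * (r + 1) := by
    rw [← probReal_compl_eq_one_sub h0]
    refine le_trans (ENNReal.toReal_mono (measure_ne_top _ _) (measure_mono_ae ?_)) hp1
    filter_upwards [hae] with μ hμ h
    obtain ⟨n, hn⟩ := hμ
    have hn0 : (μ : Measure X) B ≠ 0 := h
    change 1 ≤ (μ : Measure X) B
    rw [hn] at hn0 ⊢
    exact_mod_cast Nat.one_le_iff_ne_zero.2 (by exact_mod_cast hn0)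
  -- Integrality leaves only `N = 0` and `N ≥ 2`; on the former `ψ` agrees with its value at the
  -- zero measure, which is `0`.
  have hrest : ∫ μ in {μ | (μ : Measure X) B = 1}ᶜ, ψ μ ∂P
      = ∫ μ in {μ | 2 ≤ (μ : Measure X) B}, ψ μ ∂P := by
    refine setIntegral_eq_of_subset_of_ae_sdiff_eq_zero h1.compl.nullMeasurableSet ?_ ?_
    · intro μ (hμ : 2 ≤ (μ : Measure X) B) (h : (μ : Measure X) B = 1)
      rw [h] at hμ
      norm_num at hμ
    · filter_upwards [hae] with μ hμ h
      obtain ⟨n, hn⟩ := hμ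
      have hne : (μ : Measure X) B ≠ 1 := h.1
      have hlt : ¬ 2 ≤ (μ : Measure X) B := h.2
      rw [hn] at hne hlt
      have hn1 : n ≠ 1 := by exact_mod_cast hne
      have hn2 : ¬ 2 ≤ n := by exact_mod_cast hlt
      obtain rfl : n = 0 := by omega
      rw [Nat.cast_zero] at hn
      rw [← hψ0]
      refine eq_of_eval_eq (fun B' _ hs => ?_) hψ
      rw [measure_mono_null hs hn]
      rfl
  have hI : |∫ x in B, ψ (unitMass x) ∂(σ : Measure X)| ≤ C * r :=
    norm_setIntegral_le_of_norm_le_const (f := fun x => ψ (unitMass x)) hσ fun x _ => hC _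
  have hJ : |∫ μ in {μ | 2 ≤ (μ : Measure X) B}, ψ μ ∂P| ≤ C * (z * (r + 1)) ^ 2 :=
    (norm_setIntegral_le_of_norm_le_const (f := ψ) (measure_lt_top _ _) fun x _ => hC _).trans
      (mul_le_mul_of_nonneg_left hp2 hC0)
  rw [← integral_add_compl h1 hint, hrest, hP.setIntegral_eval_eq_one hz hB hψ]
  set I := ∫ x in B, ψ (unitMass x) ∂(σ : Measure X)
  set J := ∫ μ in {μ | 2 ≤ (μ : Measure X) B}, ψ μ ∂P
  set p := P.real {μ | (μ : Measure X) B = 0}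
  have hp : 0 ≤ 1 - p := sub_nonneg.2 measureReal_le_one
  -- Both errors are quadratic in `z`: `J` by the bound on `P(N ≥ 2)`, and `z (1 - p) I` because `1
  -- - p` is itself of order `z`.
  calc |z * p * I + J - z * I| = |J - z * (1 - p) * I| := by congr 1; ring
    _ ≤ |J| + |z * (1 - p) * I| := abs_sub _ _
    _ = |J| + z * (1 - p) * |I| := by rw [abs_mul, abs_of_nonneg (mul_nonneg hz hp)]
    _ ≤ C * (z * (r + 1)) ^ 2 + z * (z * (r + 1)) * (C * (r + 1)) := by
        gcongr
        exact hI.trans (by gcongr; linarith)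
    _ = 2 * C * (r + 1) ^ 2 * z ^ 2 := by ring

end SmallParameter

/-! ### The generator -/

section Generator

variable {X : Type*} [MetricSpace X] [MeasurableSpace X]

lemma integral_conv_dirac (P : Measure (LocFinMeasure X)) [SFinite P] (ν : LocFinMeasure X)
    {φ : LocFinMeasure X → ℝ} (hφ : Measurable φ) :
    ∫ μ, φ μ ∂(P.conv (Measure.dirac ν)) = ∫ μ, φ (μ + ν) ∂P := by
  rw [Measure.conv, Measure.prod_dirac, Measure.map_map measurable_add (by fun_prop)]
  exact integral_map (measurable_add_const ν).aemeasurable hφ.aestronglyMeasurable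

lemma polyaSum_isPapangelou [BorelSpace X] [SecondCountableTopology X] {z : ℝ} (hz0 : 0 ≤ z)
    (hz1 : z < 1) (ρ : LocFinMeasure X) :
    IsPapangelou (polyaSum z ρ)
      fun μ => ENNReal.ofReal z • ((ρ + μ : LocFinMeasure X) : Measure X) := by
  have h := exists_isPapangelou hz0 hz1 ρ
  rw [polyaSum, dif_pos h]
  exact h.choose_spec

lemma apply_add_unitMass_of_notMem {B : Set X} (hB : MeasurableSet B) {φ : LocFinMeasure X → ℝ}
    (hφ : Measurable[localSigma B] φ) (ν : LocFinMeasure X) {x : X} (hx : x ∉ B) :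
    φ (ν + unitMass x) = φ ν := by
  refine eq_of_eval_eq (fun B' _ hs => ?_) hφ
  rw [add_comm]
  exact add_eval_of_null (unitMass_apply_of_notMem hB hx) hs

/-- A point outside `B` is invisible to `φ`, so the integrand is bounded and supported in a set of
finite measure. -/
lemma integrable_apply_add_unitMass_sub {B : Set X} (hB : MeasurableSet B)
    (hb : Bornology.IsBounded B) {φ : LocFinMeasure X → ℝ} {C : ℝ} (hC : ∀ μ, |φ μ| ≤ C)
    (hφ : Measurable[localSigma B] φ) (σ ν : LocFinMeasure X) :
    Integrable (fun x => φ (ν + unitMass x) - φ ν) (σ : Measure X) := by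
  have hφ' : Measurable φ := hφ.mono (localSigma_le B) le_rfl
  have hm : Measurable fun x => φ (ν + unitMass x) - φ ν :=
    (hφ'.comp (measurable_const.add measurable_unitMass)).sub_const _
  rw [← integrableOn_iff_integrable_of_support_subset (s := B)]
  · refine Measure.integrableOn_of_bounded (M := C + C) (σ.2 B hB hb).ne hm.aestronglyMeasurable
      (Eventually.of_forall fun x => ?_)
    exact (abs_sub _ _).trans (add_le_add (hC _) (hC _))
  · intro x hx
    by_contra h
    exact hx (sub_eq_zero.2 (apply_add_unitMass_of_notMem hB hφ ν h))

lemma hasGeneratorAt [BorelSpace X] [SecondCountableTopology X] {B : Set X}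
    (hB : MeasurableSet B) (hb : Bornology.IsBounded B) {φ : LocFinMeasure X → ℝ} {C : ℝ}
    (hC : ∀ μ, |φ μ| ≤ C) (hφ : Measurable[localSigma B] φ) (ρ ν : LocFinMeasure X) {s : ℝ}
    (hs : s < 1) :
    HasGeneratorAt ρ s φ ν (1 / (1 - s) *
      ∫ x, (φ (ν + unitMass x) - φ ν) ∂((ρ + ν : LocFinMeasure X) : Measure X)) := by
  have hφ' : Measurable φ := hφ.mono (localSigma_le B) le_rfl
  have hs' : 0 < 1 - s := sub_pos.2 hs
  set σ : LocFinMeasure X := ρ + ν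
  set I := ∫ x, (φ (ν + unitMass x) - φ ν) ∂(σ : Measure X)
  have hI : I = ∫ x in B, (φ (unitMass x + ν) - φ ν) ∂(σ : Measure X) := by
    simp_rw [add_comm _ ν]
    exact (setIntegral_eq_integral_of_forall_compl_eq_zero fun x hx =>
      sub_eq_zero.2 (apply_add_unitMass_of_notMem hB hφ ν hx)).symm
  have hψ : Measurable[localSigma B] fun μ => φ (μ + ν) - φ ν := by
    refine Measurable.sub_const (hφ.comp (measurable_localSigma_of_eval fun B' hB' hsub => ?_)) _
    exact (measurable_localSigma_eval hB' hsub).add_const _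
  -- The bound of `IsPapangelou.abs_integral_sub_le` at `z = h / (1 - s)`, divided by `h ^ 2`; here
  -- `C + C` bounds the increment of `φ`.
  set K := 2 * (C + C) * ((σ : Measure X).real B + 1) ^ 2 / (1 - s) ^ 2 with hK
  -- The upper limit on `h` keeps the parameter `h / (1 - s)` below `1`, where the process is known
  -- to exist.
  have hbound : ∀ h ∈ Set.Ioo 0 (1 - s),
      ‖(1 / h) * (∫ μ, φ μ ∂(transition ρ s (s + h) ν) - φ ν) - 1 / (1 - s) * I‖ ≤ K * h := by
    intro h hh
    have hz0 : 0 ≤ h / (1 - s) := (div_pos hh.1 hs').le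
    have hz1 : h / (1 - s) < 1 := (div_lt_one hs').2 hh.2
    have hP := polyaSum_isPapangelou hz0 hz1 σ
    have hprob := hP.isPointProcess.isProbabilityMeasure
    have hest := hP.abs_integral_sub_le hz0 hB hb hψ (by rw [zero_add, sub_self]) (C := C + C)
      fun μ => (abs_sub _ _).trans (add_le_add (hC _) (hC _))
    rw [← hI, integral_sub, integral_const, probReal_univ, one_smul] at hest
    · rw [transition, add_sub_cancel_left, integral_conv_dirac _ ν hφ', Real.norm_eq_abs]
      have e : ∀ E : ℝ, 1 / h * (E - φ ν) - 1 / (1 - s) * I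
          = 1 / h * (E - φ ν - h / (1 - s) * I) := by
        intro E
        have := hh.1.ne'
        field_simp
      rw [e, abs_mul, abs_of_pos (one_div_pos.2 hh.1)]
      refine (mul_le_mul_of_nonneg_left hest (one_div_pos.2 hh.1).le).trans_eq ?_
      have := hh.1.ne'
      rw [hK]
      field_simp
    · exact Integrable.of_bound (hφ'.comp (measurable_add_const ν)).aestronglyMeasurable C
        (Eventually.of_forall fun μ => hC _)
    · exact integrable_const _
  rw [HasGeneratorAt, tendsto_iff_norm_sub_tendsto_zero]
  refine squeeze_zero' (Eventually.of_forall fun _ => norm_nonneg _)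
    (g := fun h => K * h) ?_ ?_
  · filter_upwards [Ioo_mem_nhdsGT hs'] with h hh using hbound h hh
  · have : Tendsto (fun h : ℝ => K * h) (𝓝 0) (𝓝 (K * 0)) := tendsto_id.const_mul K
    rw [mul_zero] at this
    exact this.mono_left nhdsWithin_le_nhds

end Generator

end PolyaSum

theorem mainTheorem3 {X : Type*} [MetricSpace X] [PolishSpace X] [MeasurableSpace X] [BorelSpace X]
    (ρ ν : PolyaSum.LocFinMeasure X) (s : ℝ) (hs0 : 0 ≤ s) (hs1 : s < 1)
    (B : Set X) (hB : MeasurableSet B) (hBb : Bornology.IsBounded B)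
    (φ : PolyaSum.LocFinMeasure X → ℝ) (hφb : ∃ C : ℝ, ∀ μ, |φ μ| ≤ C)
    (hφm : Measurable[PolyaSum.localSigma B] φ) :
    Integrable (fun x : X => φ (ν + PolyaSum.unitMass x) - φ ν)
        ((ρ + ν : PolyaSum.LocFinMeasure X) : Measure X) ∧
      PolyaSum.HasGeneratorAt ρ s φ ν
        (1 / (1 - s) * ∫ x, (φ (ν + PolyaSum.unitMass x) - φ ν)
          ∂((ρ + ν : PolyaSum.LocFinMeasure X) : Measure X)) := by
  obtain ⟨C, hC⟩ := hφb
  exact ⟨PolyaSum.integrable_apply_add_unitMass_sub hB hBb hC hφm (ρ + ν) ν,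
    PolyaSum.hasGeneratorAt hB hBb hC hφm ρ ν hs1⟩
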